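/- Let $m$ be Lebesgue measure on $[0,1]$. A piecewise expanding map is a map $T:[0,1]\to[0,1]$ together with a finite partition $\mathcal A_T$ of $[0,1]$ into non-degenerate intervals with disjoint interiors such that, on the interior of each interval of $\mathcal A_T$, $T$ coincides with a function which is $C^2$ on a neighbourhood of the closed interval, and such that $\inf|T'|>1$ (the infimum over the interiors of the intervals). Its transfer operator $P_T:L^1(m)\to L^1(m)$ is given by $\int P_Tf\cdot g\,dm=\int f\cdot g\circ T\,dm$ for $f\in L^1(m)$, $g\in L^\infty(m)$. For $f\in L^1(m)$ let $V(f)$ be the infimum of the total variations on $[0,1]$ of the functions equal to $f$ almost everywhere, let $\|f\|_{BV}=V(f)+\|f\|_{L^1(m)}$, and let $BV=\{f\in L^1(m): V(f)<\infty\}$. Let $\mathcal C$ be a class of piecewise expanding maps such that: 1. $(D_r)$ for some integer $r\ge1$: there are $0<\rho<1$ and $M_0,C_0>0$ such that $\|P_Tf\|_{BV}\le M_0\|f\|_{BV}$ for all $T\in\mathcal C$ and $f\in BV$, and $\|P_{S_r}\cdots P_{S_1}f\|_{BV}\le\rho\|f\|_{BV}+C_0\|f\|_{L^1(m)}$ for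 all $S_1,\dots,S_r\in\mathcal C$ and $f\in BV$; 2. (Dec): there are $0\le\theta<1$ and $K>0$ such that $\|P_{S_l}\cdots P_{S_1}f\|_{BV}\le K\theta^l\|f\|_{BV}$ for all $l\ge1$, all $S_1,\dots,S_l\in\mathcal C$ and all $f\in BV$ with $\int f\,dm=0$; 3. there are $\lambda>1$ and $M\ge1$ such that $|T'|\ge\lambda$ and $|T''|\le M$ on the interiors of the intervals of $\mathcal A_T$, for all $T\in\mathcal C$; 4. there is $N\ge1$ such that $\mathcal A_T$ has at most $N$ elements for all $T\in\mathcal C$. Let $(T_n)_{n\ge1}$ be a sequence in $\mathcal C$, put $T_1^0=\mathrm{id}$ and $T_1^n=T_n\circ\cdots\circ T_1$, and suppose that (Min) holds: there is $\delta>0$ such that $P_{T_1^n}\mathbf 1\ge\delta$ $m$-almost everywhere for all $n\ge1$. Then there exists $C>0$ such that for every $L>0$, every function $f:[0,1]\to\mathbb R$ with $|f(x)-f(y)|\le L|x-y|$ for all $x,y$, all $n\ge1$ and all $t>0$, $$m\left(\frac1n\sum_{k=0}^{n-1}\Big[f\circ T_1^k-\int f\circ T_1^k\,dm\Big]>t\right)\le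 e^{-\frac{C n t^2}{L^2}}.$$ In particular, for non-constant $f$ one may take for $L$ the least Lipschitz constant $\mathrm{Lip}(f)$; for constant $f$ the left-hand side is $0$. -/

import Mathlib

open MeasureTheory Set
open scoped NNReal ENNReal

noncomputable section

namespace SeqDyn

/-- The map `T : [0,1] → [0,1]`, viewed as a function `ℝ → ℝ` (it is constant to the left of `0` and
to the right of `1`), so that its derivatives at interior points of `[0,1]` make sense. -/
def lift (T : unitInterval → unitInterval) (x : ℝ) : ℝ :=
  (T (projIcc (0 : ℝ) 1 zero_le_one x) : ℝ)

/-- A piecewise expanding map of `[0,1]`, together with its partition: there are cut points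
`0 = c₀ < c₁ < ⋯ < c_N = 1` such that on each `(c_i, c_{i+1})` the map coincides with a function of
class `C²` on a neighbourhood of `[c_i, c_{i+1}]`, and `inf |T'| > 1`. The values of the map at the
cut points are not restricted. -/
structure PiecewiseExpandingMap where
  toFun : unitInterval → unitInterval
  pieces : ℕ
  cut : Fin (pieces + 1) → ℝ
  cut_strictMono : StrictMono cut
  cut_zero : cut 0 = 0
  cut_last : cut (Fin.last pieces) = 1
  exists_extension : ∀ i : Fin pieces, ∃ (U : Set ℝ) (g : ℝ → ℝ), IsOpen U ∧
    Icc (cut i.castSucc) (cut i.succ) ⊆ U ∧ ContDiffOn ℝ 2 g U ∧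
    EqOn (lift toFun) g (Ioo (cut i.castSucc) (cut i.succ))
  expanding : ∃ lam : ℝ, 1 < lam ∧ ∀ i : Fin pieces,
    ∀ x ∈ Ioo (cut i.castSucc) (cut i.succ), lam ≤ |deriv (lift toFun) x|

/-- The transfer operator `P_T` with respect to Lebesgue measure `m` on `[0,1]`: `P_T f` is the
density with respect to `m` of the image under `T` of the signed measure `f dm`
(computed separately for the positive and the negative part of `f`). -/
def transferOp (T : unitInterval → unitInterval) (f : unitInterval → ℝ) (x : unitInterval) : ℝ :=
  ((((volume.withDensity fun y => ENNReal.ofReal (f y)).map T).rnDeriv volume x).toReal) -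
  ((((volume.withDensity fun y => ENNReal.ofReal (-f y)).map T).rnDeriv volume x).toReal)

/-- `P_{S_l} ⋯ P_{S_1} f`, where the tuple `(S_1, …, S_l)` is `(S 0, …, S (l - 1))`. -/
def transferIter (S : ℕ → PiecewiseExpandingMap) : ℕ → (unitInterval → ℝ) → (unitInterval → ℝ)
  | 0, f => f
  | l + 1, f => transferOp (S l).toFun (transferIter S l f)

/-- `T_1^n = T_n ∘ ⋯ ∘ T_1` (with `T_1^0 = id`), where the sequence `(T_n)_{n ≥ 1}` is indexed from
zero: `T k` is the map `T_{k+1}`. -/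
def orbitMap (T : ℕ → PiecewiseExpandingMap) : ℕ → unitInterval → unitInterval
  | 0 => id
  | n + 1 => (T n).toFun ∘ orbitMap T n

/-- The variation of a class of functions modulo a.e. equality: the infimum of the variations
on `[0,1]` of all the versions of `f`. -/
def essVar (f : unitInterval → ℝ) : ℝ≥0∞ :=
  ⨅ (g : unitInterval → ℝ) (_ : g =ᵐ[volume] f), eVariationOn g univ

/-- The norm `‖f‖_BV = V(f) + ‖f‖_{L¹}`, with values in `[0, ∞]`. -/
def bvNorm (f : unitInterval → ℝ) : ℝ≥0∞ :=
  essVar f + eLpNorm f 1 volume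

/-- `f` belongs to the space BV. -/
def MemBV (f : unitInterval → ℝ) : Prop :=
  Integrable f volume ∧ essVar f < ∞

/-- The condition `(D_r)`: the transfer operators of the maps of the class are uniformly bounded on
BV, and all compositions of `r` of them satisfy a common Lasota-Yorke inequality. -/
def ConditionD (𝒞 : Set PiecewiseExpandingMap) (r : ℕ) : Prop :=
  ∃ ρ M₀ C : ℝ≥0, 0 < ρ ∧ ρ < 1 ∧ 0 < M₀ ∧ 0 < C ∧
    (∀ T ∈ 𝒞, ∀ f, MemBV f → bvNorm (transferOp T.toFun f) ≤ M₀ * bvNorm f) ∧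
    (∀ S : ℕ → PiecewiseExpandingMap, (∀ k < r, S k ∈ 𝒞) → ∀ f, MemBV f →
      bvNorm (transferIter S r f) ≤ ρ * bvNorm f + C * eLpNorm f 1 volume)

/-- The decorrelation property (Dec) on the space of BV functions with zero average. -/
def ConditionDec (𝒞 : Set PiecewiseExpandingMap) : Prop :=
  ∃ θ K : ℝ≥0, θ < 1 ∧ 0 < K ∧
    ∀ l : ℕ, 1 ≤ l → ∀ S : ℕ → PiecewiseExpandingMap, (∀ k < l, S k ∈ 𝒞) →
      ∀ f, MemBV f → ∫ x, f x = 0 → bvNorm (transferIter S l f) ≤ K * θ ^ l * bvNorm f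

/-- The assumptions on the class of maps. -/
structure AdmissibleClass (𝒞 : Set PiecewiseExpandingMap) : Prop where
  condD : ∃ r : ℕ, 1 ≤ r ∧ ConditionD 𝒞 r
  dec : ConditionDec 𝒞
  bounds : ∃ lam M : ℝ, 1 < lam ∧ 1 ≤ M ∧ ∀ T ∈ 𝒞, ∀ i : Fin T.pieces,
    ∀ x ∈ Ioo (T.cut i.castSucc) (T.cut i.succ),
      lam ≤ |deriv (lift T.toFun) x| ∧ |iteratedDeriv 2 (lift T.toFun) x| ≤ M
  pieces_le : ∃ N : ℕ, 1 ≤ N ∧ ∀ T ∈ 𝒞, T.pieces ≤ N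

/-- The minoration condition (Min): `P_{T_1^n} 1 ≥ δ` almost everywhere, for some `δ > 0` and
all `n`. -/
def ConditionMin (T : ℕ → PiecewiseExpandingMap) : Prop :=
  ∃ δ : ℝ, 0 < δ ∧ ∀ n : ℕ, 1 ≤ n →
    ∀ᵐ x : unitInterval, δ ≤ transferOp (orbitMap T n) (fun _ => 1) x

end SeqDyn

end

/-! Doob's martingale of the Birkhoff sum is taken along the decreasing `σ`-algebras generated by
the maps `T₁ᵏ`. Given `T₁ᵏ`, the terms of index at least `k` are known, so the increments are
bounded once the conditional expectations of the past sums are. For `j < k` and a centred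
observable `φ`, `E[φ ∘ T₁ʲ | T₁ᵏ]` is the ratio of `P_{T_k} ⋯ P_{T_{j+1}} (φ · P_{T₁ʲ} 1)` to
`P_{T₁ᵏ} 1`, composed with `T₁ᵏ`. Iterating `(D_r)` bounds the densities `P_{T₁ʲ} 1` in `BV`, so
that `(Dec)` makes the numerator exponentially small in `k - j` and `(Min)` keeps the denominator
away from zero. Summing over `j` gives bounded increments, and the Azuma–Hoeffding inequality
concludes. -/

namespace SeqDyn

open ProbabilityTheory

section Azuma

variable {Ω : Type*} {m mΩ : MeasurableSpace Ω} [StandardBorelSpace Ω] {μ : Measure Ω}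

theorem hasCondSubgaussianMGF_of_mem_Icc_of_condExp_eq_zero [IsFiniteMeasure μ] (hm : m ≤ mΩ)
    {X : Ω → ℝ} {a b : ℝ} (hX : Measurable X) (hab : ∀ᵐ ω ∂μ, X ω ∈ Icc a b)
    (h0 : μ[X | m] =ᵐ[μ] 0) :
    HasCondSubgaussianMGF m hm X ((‖b - a‖₊ / 2) ^ 2) μ where
  integrable_exp_mul t := by
    rw [condExpKernel_comp_trim hm]
    exact integrable_exp_mul_of_mem_Icc hX.aemeasurable hab
  mgf_le := by
    have hX_int : Integrable X μ := Integrable.of_mem_Icc a b hX.aemeasurable hab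
    have h0_trim : μ[X | m] =ᵐ[μ.trim hm] 0 :=
      (stronglyMeasurable_condExp.ae_eq_trim_iff hm stronglyMeasurable_zero).2 h0
    have hab_kernel : ∀ᵐ ω ∂(μ.trim hm), ∀ᵐ ω' ∂(condExpKernel μ m ω), X ω' ∈ Icc a b :=
      Measure.ae_ae_of_ae_comp (by rwa [condExpKernel_comp_trim hm])
    filter_upwards [hab_kernel, h0_trim, condExp_ae_eq_trim_integral_condExpKernel hm hX_int]
      with ω habω h0ω hω
    exact (hasSubgaussianMGF_of_mem_Icc_of_integral_eq_zero hX.aemeasurable habω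
      (hω.symm.trans h0ω)).mgf_le

theorem measureReal_martingale_ge_le [IsProbabilityMeasure μ] {ℱ : Filtration ℕ mΩ}
    {M : ℕ → Ω → ℝ} (hM : Martingale M ℱ μ) (h0 : ∫ ω, M 0 ω ∂μ = 0) {c : ℕ → ℝ≥0} {n : ℕ}
    (hc0 : ∀ᵐ ω ∂μ, |M 0 ω| ≤ c 0) (hc : ∀ i < n, ∀ᵐ ω ∂μ, |M (i + 1) ω - M i ω| ≤ c (i + 1))
    {ε : ℝ} (hε : 0 ≤ ε) :
    μ.real {ω | ε ≤ M n ω} ≤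
      Real.exp (-ε ^ 2 / (2 * ∑ i ∈ Finset.range (n + 1), (c i : ℝ) ^ 2)) := by
  let Y (i : ℕ) : Ω → ℝ := if i = 0 then M 0 else M i - M (i - 1)
  have hY_sum (ω : Ω) : ∑ i ∈ Finset.range (n + 1), Y i ω = M n ω := by
    simp [Y, Finset.sum_range_succ', Finset.sum_range_sub (fun i => M i ω)]
  have hY_adapted : StronglyAdapted ℱ Y := by
    rintro (_ | i)
    · exact hM.1 0
    · exact (hM.1 (i + 1)).sub ((hM.1 i).mono (ℱ.mono i.le_succ))
  have hwidth (d : ℝ≥0) : (‖(d : ℝ) - -d‖₊ / 2) ^ 2 = d ^ 2 := by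
    rw [sub_neg_eq_add, ← NNReal.coe_add, Real.nnnorm_of_nonneg (NNReal.coe_nonneg _)]
    congr 1
    ext
    push_cast
    simp
  have hY_zero : HasSubgaussianMGF (Y 0) (c 0 ^ 2) μ := by
    rw [← hwidth]
    exact hasSubgaussianMGF_of_mem_Icc_of_integral_eq_zero
      ((hM.1 0).mono (ℱ.le 0)).measurable.aemeasurable (hc0.mono fun ω => abs_le.1) h0
  have hY_succ (i : ℕ) (hi : i < n) :
      HasCondSubgaussianMGF (ℱ i) (ℱ.le i) (Y (i + 1)) (c (i + 1) ^ 2) μ := by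
    rw [← hwidth]
    refine hasCondSubgaussianMGF_of_mem_Icc_of_condExp_eq_zero (ℱ.le i)
      ((hY_adapted (i + 1)).mono (ℱ.le _)).measurable ((hc i hi).mono fun ω => abs_le.1) ?_
    calc μ[M (i + 1) - M i | ℱ i] =ᵐ[μ] μ[M (i + 1) | ℱ i] - μ[M i | ℱ i] :=
          condExp_sub (hM.integrable _) (hM.integrable _) _
      _ =ᵐ[μ] M i - M i := (hM.2 i _ i.le_succ).sub (hM.2 i i le_rfl)
      _ = 0 := sub_self _
  simpa [hY_sum] using measure_sum_ge_le_of_hasCondSubgaussianMGF (cY := fun i => c i ^ 2)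
    hY_adapted hY_zero (n + 1) (fun i hi => hY_succ i hi) hε

end Azuma

section Reversed

variable {Ω : Type*} {mΩ : MeasurableSpace Ω} {μ : Measure Ω}
  {𝒢 : ℕ → MeasurableSpace Ω} {X : ℕ → Ω → ℝ}

theorem condExp_sum_range_ae_eq [IsFiniteMeasure μ] (h𝒢 : Antitone 𝒢) (h𝒢_le : ∀ k, 𝒢 k ≤ mΩ)
    (hX : ∀ k, StronglyMeasurable[𝒢 k] (X k)) (hX_int : ∀ k, Integrable (X k) μ) {k n : ℕ}
    (hkn : k ≤ n) :
    μ[∑ j ∈ Finset.range n, X j | 𝒢 k] =ᵐ[μ]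
      μ[∑ j ∈ Finset.range k, X j | 𝒢 k] + ∑ j ∈ Finset.Ico k n, X j := by
  have h_int (s : Finset ℕ) : Integrable (∑ j ∈ s, X j) μ :=
    integrable_finsetSum' s fun j _ => hX_int j
  rw [← Finset.sum_range_add_sum_Ico _ hkn]
  refine (condExp_add (h_int _) (h_int _) _).trans (.of_eq ?_)
  rw [condExp_of_stronglyMeasurable (h𝒢_le k) _ (h_int (Finset.Ico k n))]
  exact Finset.stronglyMeasurable_sum _ fun j hj => (hX j).mono (h𝒢 (Finset.mem_Ico.1 hj).1)

theorem measureReal_sum_range_ge_le [StandardBorelSpace Ω] [IsProbabilityMeasure μ]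
    (h𝒢 : Antitone 𝒢) (h𝒢_le : ∀ k, 𝒢 k ≤ mΩ) (hX : ∀ k, StronglyMeasurable[𝒢 k] (X k)) {a b : ℝ≥0}
    (hXa : ∀ k, ∀ᵐ ω ∂μ, |X k ω| ≤ a) (hX0 : ∀ k, ∫ ω, X k ω ∂μ = 0)
    (hXb : ∀ k, ∀ᵐ ω ∂μ, |(μ[∑ j ∈ Finset.range k, X j | 𝒢 k]) ω| ≤ b) (n : ℕ) {ε : ℝ}
    (hε : 0 ≤ ε) :
    μ.real {ω | ε ≤ ∑ k ∈ Finset.range n, X k ω} ≤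
      Real.exp (-ε ^ 2 / (2 * ((n + 1) * (a + 2 * b) ^ 2))) := by
  let S (k : ℕ) : Ω → ℝ := ∑ j ∈ Finset.range k, X j
  have hX_int (k : ℕ) : Integrable (X k) μ :=
    .of_bound ((hX k).mono (h𝒢_le k)).aestronglyMeasurable a (hXa k)
  let ℱ : Filtration ℕ mΩ :=
    ⟨fun i => 𝒢 (n - i), fun i j hij => h𝒢 (Nat.sub_le_sub_left hij n), fun i => h𝒢_le _⟩
  have hM0 : ∫ ω, (μ[S n | ℱ 0]) ω ∂μ = 0 := by
    rw [integral_condExp (ℱ.le 0)]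
    simp [S, integral_finsetSum _ fun j _ => hX_int j, hX0]
  have hS_meas : StronglyMeasurable[ℱ n] (S n) :=
    Finset.stronglyMeasurable_sum _ fun j _ => (hX j).mono (h𝒢 (by simp))
  have hMn : μ[S n | ℱ n] = S n := condExp_of_stronglyMeasurable (ℱ.le n) hS_meas
    (integrable_finsetSum' _ fun j _ => hX_int j)
  -- `E[S n | 𝒢 k] = E[S k | 𝒢 k] + ∑ j ∈ [k, n), X j`, so an increment only involves `X k` and the
  -- two conditional expectations of the past.
  have hM_diff (i : ℕ) (hi : i < n) :
      ∀ᵐ ω ∂μ, |(μ[S n | ℱ (i + 1)]) ω - (μ[S n | ℱ i]) ω| ≤ (a + 2 * b : ℝ≥0) := by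
    obtain ⟨k, rfl⟩ : ∃ k, n = i + (k + 1) := ⟨n - i - 1, by omega⟩
    have hℱ_succ : ℱ (i + 1) = 𝒢 k := congrArg 𝒢 (by omega)
    have hℱ : ℱ i = 𝒢 (k + 1) := congrArg 𝒢 (by omega)
    rw [hℱ_succ, hℱ]
    filter_upwards [hXa k, hXb k, hXb (k + 1),
      condExp_sum_range_ae_eq h𝒢 h𝒢_le hX hX_int (show k ≤ i + (k + 1) by omega),
      condExp_sum_range_ae_eq h𝒢 h𝒢_le hX hX_int (show k + 1 ≤ i + (k + 1) by omega)]
      with ω ha hb hb' hk hk'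
    rw [hk, hk', Finset.sum_eq_sum_Ico_succ_bot (by omega)]
    simp only [Pi.add_apply, NNReal.coe_add, NNReal.coe_mul, NNReal.coe_ofNat]
    rw [abs_le] at ha hb hb' ⊢
    constructor <;> linarith
  have hM_zero : ∀ᵐ ω ∂μ, |(μ[S n | ℱ 0]) ω| ≤ (a + 2 * b : ℝ≥0) := by
    filter_upwards [hXb n] with ω hω
    refine hω.trans ?_
    push_cast
    linarith [a.2, b.2]
  simpa [hMn, S] using measureReal_martingale_ge_le (martingale_condExp (S n) ℱ μ) hM0
    (c := fun _ => a + 2 * b) hM_zero hM_diff hε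

end Reversed

theorem exists_forall_le_of_forall_add_le {b : ℕ → ℝ≥0} {ρ C : ℝ≥0} {r : ℕ} (hr : 0 < r)
    (hρ : ρ < 1) (hb : ∀ k, b (k + r) ≤ ρ * b k + C) : ∃ B, ∀ k, b k ≤ B := by
  have hρ' : 0 < 1 - ρ := tsub_pos_of_lt hρ
  set B : ℝ≥0 := ∑ i ∈ Finset.range r, b i + C / (1 - ρ)
  have hB_fixed : ρ * B + C ≤ B := calc
    ρ * B + C = ρ * B + (1 - ρ) * (C / (1 - ρ)) := by rw [mul_div_cancel₀ _ hρ'.ne']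
    _ ≤ ρ * B + (1 - ρ) * B := by gcongr; exact le_add_self
    _ = B := by rw [← add_mul, add_tsub_cancel_of_le hρ.le, one_mul]
  refine ⟨B, fun k => ?_⟩
  induction k using Nat.strong_induction_on with
  | _ k ih =>
    rcases lt_or_ge k r with hk | hk
    · exact (Finset.single_le_sum (fun _ _ => zero_le) (Finset.mem_range.2 hk)).trans le_self_add
    · obtain ⟨j, rfl⟩ := Nat.exists_eq_add_of_le' hk
      calc b (j + r) ≤ ρ * b j + C := hb j
        _ ≤ ρ * B + C := by gcongr; exact ih j (by omega)
        _ ≤ B := hB_fixed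

section BoundedVariation

variable {f g φ : unitInterval → ℝ}

theorem bvNorm_congr_ae (h : f =ᵐ[volume] g) : bvNorm f = bvNorm g := by
  simp only [bvNorm, essVar, eLpNorm_congr_ae h]
  congr! 4 with u
  exact ⟨fun hu : u =ᵐ[volume] f => hu.trans h, fun hu : u =ᵐ[volume] g => hu.trans h.symm⟩

theorem bvNorm_eq_iInf (f : unitInterval → ℝ) :
    bvNorm f = ⨅ g : {g : unitInterval → ℝ // g =ᵐ[volume] f},
      (eVariationOn g.1 univ + eLpNorm g.1 1 volume) := by
  rw [bvNorm, essVar, iInf_subtype', ENNReal.iInf_add]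
  exact iInf_congr fun g => by rw [eLpNorm_congr_ae g.2]

theorem bvNorm_le_eVariationOn_add (f : unitInterval → ℝ) :
    bvNorm f ≤ eVariationOn f univ + eLpNorm f 1 volume :=
  (bvNorm_eq_iInf f).trans_le (iInf_le _ (⟨f, ae_eq_rfl⟩ : {g // g =ᵐ[volume] f}))

theorem memBV_iff : MemBV f ↔ Integrable f ∧ bvNorm f < ∞ := by
  refine and_congr_right fun hf => ?_
  rw [bvNorm, ENNReal.add_lt_top, and_iff_left (memLp_one_iff_integrable.2 hf).2]

theorem memBV_const (c : ℝ) : MemBV fun _ => c := by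
  refine memBV_iff.2 ⟨integrable_const c, (bvNorm_le_eVariationOn_add _).trans_lt ?_⟩
  rw [eVariationOn.constant_on (subsingleton_singleton.anti
    (image_subset_range _ _ |>.trans range_const_subset)), zero_add]
  exact (memLp_const c).2

theorem enorm_le_eVariationOn_add_eLpNorm (g : unitInterval → ℝ) (x : unitInterval) :
    ‖g x‖ₑ ≤ eVariationOn g univ + eLpNorm g 1 volume := by
  have hosc (y : unitInterval) : ‖g x‖ₑ ≤ eVariationOn g univ + ‖g y‖ₑ := calc
    ‖g x‖ₑ = ‖(g x - g y) + g y‖ₑ := by rw [sub_add_cancel]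
    _ ≤ edist (g x) (g y) + ‖g y‖ₑ := by rw [edist_eq_enorm_sub]; exact enorm_add_le _ _
    _ ≤ _ := by gcongr; exact eVariationOn.edist_le g (mem_univ x) (mem_univ y)
  calc ‖g x‖ₑ = ∫⁻ _ : unitInterval, ‖g x‖ₑ := by simp
    _ ≤ ∫⁻ y, (eVariationOn g univ + ‖g y‖ₑ) := lintegral_mono hosc
    _ = _ := by
      rw [lintegral_add_left measurable_const, eLpNorm_one_eq_lintegral_enorm]
      simp

theorem ae_enorm_le_bvNorm (f : unitInterval → ℝ) : ∀ᵐ x, ‖f x‖ₑ ≤ bvNorm f := by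
  have h : eLpNormEssSup f volume ≤ bvNorm f := by
    rw [bvNorm_eq_iInf]
    refine le_iInf fun g => ?_
    rw [← eLpNormEssSup_congr_ae g.2]
    exact essSup_le_of_ae_le _ (ae_of_all _ (enorm_le_eVariationOn_add_eLpNorm g.1))
  filter_upwards [enorm_ae_le_eLpNormEssSup f volume] with x hx using hx.trans h

theorem bvNorm_mul_le {c : ℝ≥0} (hφ : ∀ x, ‖φ x‖ₑ ≤ c) (hφ_var : eVariationOn φ univ ≠ ∞) :
    bvNorm (fun x => φ x * f x) ≤ (c + eVariationOn φ univ) * bvNorm f := by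
  have : Nonempty {g : unitInterval → ℝ // g =ᵐ[volume] f} := ⟨⟨f, ae_eq_rfl⟩⟩
  rw [bvNorm_eq_iInf f, ENNReal.mul_iInf fun h => absurd h (by finiteness)]
  refine le_iInf fun g => ?_
  rw [bvNorm_congr_ae (g := fun x => φ x * g.1 x) (by filter_upwards [g.2] with x hx; rw [hx])]
  set N := eVariationOn g.1 univ + eLpNorm g.1 1 volume with hN
  have hvar : eVariationOn (fun x => φ x * g.1 x) univ ≤
      c * eVariationOn g.1 univ + N * eVariationOn φ univ :=
    eVariationOn_fun_mul_le (fun x _ => hφ x) fun x _ => enorm_le_eVariationOn_add_eLpNorm g.1 x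
  have hnorm : eLpNorm (fun x => φ x * g.1 x) 1 volume ≤ c * eLpNorm g.1 1 volume := by
    simp only [eLpNorm_one_eq_lintegral_enorm, enorm_mul,
      ← lintegral_const_mul' _ _ ENNReal.coe_ne_top]
    gcongr with x
    exact hφ x
  calc bvNorm (fun x => φ x * g.1 x)
      ≤ (c * eVariationOn g.1 univ + N * eVariationOn φ univ) + c * eLpNorm g.1 1 volume :=
        (bvNorm_le_eVariationOn_add _).trans (add_le_add hvar hnorm)
    _ = (c + eVariationOn φ univ) * N := by rw [hN]; ring

theorem eVariationOn_le_of_lipschitzWith {L : ℝ≥0} (hφ : LipschitzWith L φ) :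
    eVariationOn φ univ ≤ L := by
  have hid : eVariationOn (id : unitInterval → unitInterval) univ ≤ 1 := by
    have h := (Subtype.mono_coe (· ∈ unitInterval)).monotoneOn univ |>.eVariationOn_eq
      (mem_univ (0 : unitInterval)) (mem_univ 1)
    rw [univ_inter, show Icc (0 : unitInterval) 1 = univ from Icc_bot_top] at h
    exact (show eVariationOn (id : unitInterval → unitInterval) univ = _ from h).trans_le (by simp)
  calc eVariationOn φ univ = eVariationOn (φ ∘ id) univ := rfl
    _ ≤ L * eVariationOn id univ :=
      hφ.lipschitzOnWith.comp_eVariationOn_le (mapsTo_univ id univ)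
    _ ≤ L := mul_le_of_le_one_right' hid

end BoundedVariation

section TransferOperator

variable {S T : unitInterval → unitInterval} {f g G : unitInterval → ℝ}

theorem integrable_transferOp (hf : Integrable f) : Integrable (transferOp T f) := by
  have := isFiniteMeasure_withDensity_ofReal hf.2
  have : IsFiniteMeasure (volume.withDensity fun y => ENNReal.ofReal (-f y)) :=
    isFiniteMeasure_withDensity_ofReal hf.neg.2
  exact Measure.integrable_toReal_rnDeriv.sub Measure.integrable_toReal_rnDeriv

theorem eLpNorm_transferOp_le (hT : Measurable T) (f : unitInterval → ℝ) :
    eLpNorm (transferOp T f) 1 volume ≤ eLpNorm f 1 volume := by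
  set P : Measure unitInterval := (volume.withDensity fun y => ENNReal.ofReal (f y)).map T
  set N : Measure unitInterval := (volume.withDensity fun y => ENNReal.ofReal (-f y)).map T
  have hmass (h : unitInterval → ℝ≥0∞) : (volume.withDensity h).map T univ = ∫⁻ y, h y := by
    simp [Measure.map_apply hT MeasurableSet.univ]
  have henorm (a : ℝ≥0∞) : ‖a.toReal‖ₑ ≤ a :=
    (Real.enorm_of_nonneg ENNReal.toReal_nonneg).trans_le ENNReal.ofReal_toReal_le
  rw [eLpNorm_one_eq_lintegral_enorm, eLpNorm_one_eq_lintegral_enorm]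
  calc ∫⁻ x, ‖transferOp T f x‖ₑ ≤ ∫⁻ x, (P.rnDeriv volume x + N.rnDeriv volume x) :=
        lintegral_mono fun x => enorm_sub_le.trans (add_le_add (henorm _) (henorm _))
    _ ≤ P univ + N univ := by
        rw [lintegral_add_left (Measure.measurable_rnDeriv _ _)]
        exact add_le_add Measure.lintegral_rnDeriv_le Measure.lintegral_rnDeriv_le
    _ ≤ ∫⁻ y, (ENNReal.ofReal (f y) + ENNReal.ofReal (-f y)) := by
        rw [hmass, hmass]
        exact le_lintegral_add _ _
    _ = ∫⁻ y, ‖f y‖ₑ := lintegral_congr fun y => by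
        rcases le_total 0 (f y) with h | h
        · simp [h, Real.enorm_of_nonneg]
        · simp [h, ← enorm_neg (f y), Real.enorm_of_nonneg (neg_nonneg.2 h)]

theorem transferOp_congr_ae (h : f =ᵐ[volume] g) : transferOp T f = transferOp T g := by
  have hpos : (volume.withDensity fun y => ENNReal.ofReal (f y)) =
      volume.withDensity fun y => ENNReal.ofReal (g y) :=
    withDensity_congr_ae (by filter_upwards [h] with x hx; rw [hx])
  have hneg : (volume.withDensity fun y => ENNReal.ofReal (-f y)) =
      volume.withDensity fun y => ENNReal.ofReal (-g y) :=
    withDensity_congr_ae (by filter_upwards [h] with x hx; rw [hx])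
  ext x
  rw [transferOp, transferOp, hpos, hneg]

theorem transferOp_neg (T : unitInterval → unitInterval) (f : unitInterval → ℝ) :
    transferOp T (-f) = -transferOp T f := by
  ext x
  simp [transferOp]

theorem integral_toReal_rnDeriv_map_withDensity_mul
    (hT : Measure.QuasiMeasurePreserving T volume volume) (hf : Integrable f)
    (hG : Measurable G) :
    ∫ x, (((volume.withDensity fun y => ENNReal.ofReal (f y)).map T).rnDeriv volume x).toReal * G x
      = ∫ x, max (f x) 0 * G (T x) := by
  have := isFiniteMeasure_withDensity_ofReal hf.2
  have hac : (volume.withDensity fun y => ENNReal.ofReal (f y)).map T ≪ volume :=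
    ((withDensity_absolutelyContinuous _ _).map hT.measurable).trans hT.absolutelyContinuous
  simp only [← smul_eq_mul]
  rw [integral_rnDeriv_smul hac, integral_map hT.measurable.aemeasurable hG.aestronglyMeasurable,
    integral_withDensity_eq_integral_toReal_smul₀ hf.aemeasurable.ennreal_ofReal
      (ae_of_all _ fun _ => ENNReal.ofReal_lt_top)]
  simp only [ENNReal.toReal_ofReal']

theorem integral_transferOp_mul (hT : Measure.QuasiMeasurePreserving T volume volume)
    (hf : Integrable f) (hG : Measurable G) {c : ℝ} (hc : ∀ x, |G x| ≤ c) :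
    ∫ x, transferOp T f x * G x = ∫ x, f x * G (T x) := by
  have := isFiniteMeasure_withDensity_ofReal hf.2
  have : IsFiniteMeasure (volume.withDensity fun y => ENNReal.ofReal (-f y)) :=
    isFiniteMeasure_withDensity_ofReal hf.neg.2
  have hmul {u : unitInterval → ℝ} (hu : Integrable u) : Integrable fun x => u x * G x :=
    hu.mul_bdd hG.aestronglyMeasurable (ae_of_all _ hc)
  have hmul_comp {u : unitInterval → ℝ} (hu : Integrable u) :
      Integrable fun x => u x * G (T x) :=
    hu.mul_bdd (g := fun x => G (T x)) (hG.comp hT.measurable).aestronglyMeasurable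
      (ae_of_all _ fun _ => hc _)
  simp only [transferOp, sub_mul]
  rw [integral_sub (hmul Measure.integrable_toReal_rnDeriv)
      (hmul Measure.integrable_toReal_rnDeriv),
    integral_toReal_rnDeriv_map_withDensity_mul hT hf hG,
    integral_toReal_rnDeriv_map_withDensity_mul (f := fun y => -f y) hT hf.neg hG,
    ← integral_sub (hmul_comp hf.pos_part) (hmul_comp hf.neg_part)]
  simp only [← sub_mul, max_zero_sub_max_neg_zero_eq_self]

theorem setIntegral_transferOp (hT : Measure.QuasiMeasurePreserving T volume volume)
    (hf : Integrable f) {s : Set unitInterval} (hs : MeasurableSet s) :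
    ∫ x in s, transferOp T f x = ∫ x in T ⁻¹' s, f x := by
  have hone (x : unitInterval) : |s.indicator (fun _ => (1 : ℝ)) x| ≤ 1 := by
    by_cases hx : x ∈ s <;> simp [hx]
  rw [← integral_indicator hs, ← integral_indicator (hT.measurable hs)]
  calc ∫ x, s.indicator (transferOp T f) x
      = ∫ x, transferOp T f x * s.indicator (fun _ => 1) x :=
        integral_congr_ae (ae_of_all _ fun x => by by_cases hx : x ∈ s <;> simp [hx])
    _ = ∫ x, f x * s.indicator (fun _ => 1) (T x) :=
        integral_transferOp_mul hT hf (measurable_const.indicator hs) hone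
    _ = ∫ x, (T ⁻¹' s).indicator f x :=
        integral_congr_ae (ae_of_all _ fun x => by by_cases hx : T x ∈ s <;> simp [hx])

theorem integral_transferOp (hT : Measure.QuasiMeasurePreserving T volume volume)
    (hf : Integrable f) : ∫ x, transferOp T f x = ∫ x, f x := by
  simpa using setIntegral_transferOp hT hf MeasurableSet.univ

theorem ae_eq_transferOp_of_forall_setIntegral_eq
    (hT : Measure.QuasiMeasurePreserving T volume volume) (hf : Integrable f) (hg : Integrable g)
    (h : ∀ s, MeasurableSet s → ∫ x in s, g x = ∫ x in T ⁻¹' s, f x) :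
    g =ᵐ[volume] transferOp T f :=
  hg.ae_eq_of_forall_setIntegral_eq _ _ (integrable_transferOp hf) fun s hs _ => by
    rw [h s hs, setIntegral_transferOp hT hf hs]

theorem transferOp_id_ae_eq (hf : Integrable f) : transferOp id f =ᵐ[volume] f :=
  (ae_eq_transferOp_of_forall_setIntegral_eq (.id _) hf hf fun _ _ => rfl).symm

theorem transferOp_comp_ae_eq (hS : Measure.QuasiMeasurePreserving S volume volume)
    (hT : Measure.QuasiMeasurePreserving T volume volume) (hf : Integrable f) :
    transferOp (S ∘ T) f =ᵐ[volume] transferOp S (transferOp T f) :=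
  (ae_eq_transferOp_of_forall_setIntegral_eq (hS.comp hT) hf
    (integrable_transferOp (integrable_transferOp hf)) fun s hs => by
      rw [setIntegral_transferOp hS (integrable_transferOp hf) hs,
        setIntegral_transferOp hT hf (hS.measurable hs), preimage_comp]).symm

theorem transferOp_comp_mul_ae_eq (hT : Measure.QuasiMeasurePreserving T volume volume)
    (hf : Integrable f) (hG : Measurable G) {c : ℝ} (hc : ∀ x, |G x| ≤ c) :
    transferOp T (fun x => G (T x) * f x) =ᵐ[volume] fun x => G x * transferOp T f x := by
  have hGT_int : Integrable fun x => G (T x) * f x :=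
    hf.bdd_mul (hG.comp hT.measurable).aestronglyMeasurable (ae_of_all _ fun _ => hc _)
  have hG_int : Integrable fun x => G x * transferOp T f x :=
    (integrable_transferOp hf).bdd_mul hG.aestronglyMeasurable (ae_of_all _ hc)
  refine (ae_eq_transferOp_of_forall_setIntegral_eq hT hGT_int hG_int fun s hs => ?_).symm
  have hbound (x : unitInterval) : |s.indicator G x| ≤ c :=
    (norm_indicator_le_norm_self G x).trans (hc x)
  rw [← integral_indicator hs, ← integral_indicator (hT.measurable hs)]
  calc ∫ x, s.indicator (fun x => G x * transferOp T f x) x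
      = ∫ x, transferOp T f x * s.indicator G x :=
        integral_congr_ae (ae_of_all _ fun x => by by_cases hx : x ∈ s <;> simp [hx, mul_comm])
    _ = ∫ x, f x * s.indicator G (T x) := integral_transferOp_mul hT hf (hG.indicator hs) hbound
    _ = ∫ x, (T ⁻¹' s).indicator (fun x => G (T x) * f x) x :=
        integral_congr_ae (ae_of_all _ fun x => by by_cases hx : T x ∈ s <;> simp [hx, mul_comm])

-- `E[f | T]` is `(P_T f / P_T 1) ∘ T`; comparing integrals over preimages of sets under `T` avoids
-- having to factor the conditional expectation through `T`.
theorem condExp_comap_ae_le_div (hT : Measure.QuasiMeasurePreserving T volume volume)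
    (hf : Integrable f) {c δ : ℝ} (hδ : 0 < δ) (hc : 0 ≤ c)
    (hmin : ∀ᵐ x, δ ≤ transferOp T (fun _ => 1) x) (hPf : ∀ᵐ x, transferOp T f x ≤ c) :
    ∀ᵐ x, (volume[f | MeasurableSpace.comap T inferInstance]) x ≤ c / δ := by
  have hm : MeasurableSpace.comap T inferInstance ≤ _ := hT.measurable.comap_le
  refine ae_of_ae_trim hm (ae_le_of_forall_setIntegral_le
    (integrable_condExp.trim hm stronglyMeasurable_condExp) (integrable_const (c / δ)) ?_)
  rintro _ ⟨s, hs, rfl⟩ -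
  have hone : Integrable (fun _ : unitInterval => (1 : ℝ)) := integrable_const 1
  rw [← setIntegral_trim hm stronglyMeasurable_condExp ⟨s, hs, rfl⟩,
    ← setIntegral_trim hm stronglyMeasurable_const ⟨s, hs, rfl⟩,
    setIntegral_condExp hm hf ⟨s, hs, rfl⟩]
  calc ∫ x in T ⁻¹' s, f x = ∫ x in s, transferOp T f x := (setIntegral_transferOp hT hf hs).symm
    _ ≤ ∫ x in s, c / δ * transferOp T (fun _ => 1) x := by
        refine setIntegral_mono_ae (integrable_transferOp hf).integrableOn
          ((integrable_transferOp hone).const_mul _).integrableOn ?_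
        filter_upwards [hmin, hPf] with x hx hPx
        calc transferOp T f x ≤ c / δ * δ := by rwa [div_mul_cancel₀ _ hδ.ne']
          _ ≤ _ := by gcongr
    _ = ∫ _ in T ⁻¹' s, c / δ := by
        rw [integral_const_mul, setIntegral_transferOp hT hone hs, ← integral_const_mul, mul_one]

theorem abs_condExp_comap_ae_le_div (hT : Measure.QuasiMeasurePreserving T volume volume)
    (hf : Integrable f) {c δ : ℝ} (hδ : 0 < δ)
    (hmin : ∀ᵐ x, δ ≤ transferOp T (fun _ => 1) x) (hPf : ∀ᵐ x, |transferOp T f x| ≤ c) :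
    ∀ᵐ x, |(volume[f | MeasurableSpace.comap T inferInstance]) x| ≤ c / δ := by
  have hc : 0 ≤ c := let ⟨_, hx⟩ := hPf.exists; (abs_nonneg _).trans hx
  have hle : ∀ᵐ x, transferOp T f x ≤ c := hPf.mono fun x hx => (abs_le.1 hx).2
  have hneg_le : ∀ᵐ x, transferOp T (-f) x ≤ c := hPf.mono fun x hx => by
    rw [transferOp_neg, Pi.neg_apply]
    exact neg_le.1 (abs_le.1 hx).1
  filter_upwards [condExp_comap_ae_le_div hT hf hδ hc hmin hle,
    condExp_comap_ae_le_div hT hf.neg hδ hc hmin hneg_le,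
    condExp_neg f (MeasurableSpace.comap T inferInstance)] with x h1 h2 hx
  rw [hx, Pi.neg_apply] at h2
  exact abs_le.2 ⟨neg_le.1 h2, h1⟩

end TransferOperator

section Nonsingular

theorem injOn_of_deriv_ne_zero {f : ℝ → ℝ} {s : Set ℝ} (hs : s.OrdConnected)
    (hf : ∀ x ∈ s, deriv f x ≠ 0) : InjOn f s := by
  suffices h_lt : ∀ x ∈ s, ∀ y ∈ s, x < y → f x ≠ f y by
    intro x hx y hy hxy
    by_contra hne
    rcases lt_or_gt_of_ne hne with h | h
    exacts [h_lt x hx y hy h hxy, h_lt y hy x hx h hxy.symm]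
  intro x hx y hy hxy heq
  have hcont : ContinuousOn f (Icc x y) := fun z hz =>
    (differentiableAt_of_deriv_ne_zero (hf z (hs.out hx hy hz))).continuousAt.continuousWithinAt
  obtain ⟨z, hz, hz0⟩ := exists_deriv_eq_zero hxy hcont heq
  exact hf z (hs.out hx hy (Ioo_subset_Icc_self hz)) hz0

theorem volume_eq_zero_of_volume_image_eq_zero {f : ℝ → ℝ} {s : Set ℝ} (hs : MeasurableSet s)
    (hf : ∀ x ∈ s, deriv f x ≠ 0) (hinj : InjOn f s) (himage : volume (f '' s) = 0) :
    volume s = 0 := by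
  have harea : ∫⁻ x in s, ENNReal.ofReal |deriv f x| * 1 = 0 := by
    rw [← lintegral_image_eq_lintegral_abs_deriv_mul hs (fun x hx =>
      (differentiableAt_of_deriv_ne_zero (hf x hx)).hasDerivAt.hasDerivWithinAt) hinj fun _ => 1]
    simpa using himage
  have hae : ∀ᵐ x ∂(volume.restrict s), ENNReal.ofReal |deriv f x| * 1 = 0 :=
    (lintegral_eq_zero_iff (by fun_prop)).1 harea
  rw [ae_restrict_iff' hs] at hae
  refine measure_eq_zero_iff_ae_notMem.2 (hae.mono fun x hx hxs => ?_)
  simpa [hf x hxs] using hx hxs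

theorem lift_coe (T : unitInterval → unitInterval) (x : unitInterval) : lift T x = T x := by
  simp [lift]

variable {T : unitInterval → unitInterval} {ι : Type*} {J : ι → Set ℝ}

theorem measurable_of_deriv_lift_ne_zero
    (hT : ∀ i, ∀ x ∈ J i, deriv (lift T) x ≠ 0)
    (hJ_compl : {x : unitInterval | ∀ i, (x : ℝ) ∉ J i}.Finite) : Measurable T := by
  refine measurable_of_measurable_on_compl_finite _ hJ_compl (Continuous.measurable ?_)
  rw [← continuousOn_iff_continuous_domRestrict]
  intro x hx
  obtain ⟨i, hi⟩ : ∃ i, (x : ℝ) ∈ J i := by simpa using hx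
  refine ContinuousAt.continuousWithinAt ?_
  rw [Topology.IsInducing.subtypeVal.continuousAt_iff]
  have hlift : ContinuousAt (fun y : unitInterval => lift T y) x :=
    ContinuousAt.comp (g := lift T) (differentiableAt_of_deriv_ne_zero (hT i x hi)).continuousAt
      continuous_subtype_val.continuousAt
  simpa only [Function.comp_def, lift_coe] using hlift

theorem quasiMeasurePreserving_of_deriv_lift_ne_zero [Countable ι]
    (hJ : ∀ i, (J i).OrdConnected) (hT : ∀ i, ∀ x ∈ J i, deriv (lift T) x ≠ 0)
    (hJ_compl : {x : unitInterval | ∀ i, (x : ℝ) ∉ J i}.Finite) :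
    Measure.QuasiMeasurePreserving T volume volume := by
  have hT_meas := measurable_of_deriv_lift_ne_zero hT hJ_compl
  refine ⟨hT_meas, Measure.AbsolutelyContinuous.mk fun A hA hA0 => ?_⟩
  rw [Measure.map_apply hT_meas hA]
  have hpiece (i : ι) : volume (T ⁻¹' A ∩ Subtype.val ⁻¹' J i) = 0 := by
    rw [unitInterval.volume_apply] at hA0 ⊢
    set s : Set ℝ := Subtype.val '' (T ⁻¹' A ∩ Subtype.val ⁻¹' J i)
    have hs_meas : MeasurableSet s := unitInterval.measurableEmbedding_coe.measurableSet_image.2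
      ((hT_meas hA).inter (measurable_subtype_coe (hJ i).measurableSet))
    have hsJ : s ⊆ J i := by
      rintro _ ⟨x, hx, rfl⟩
      exact hx.2
    refine volume_eq_zero_of_volume_image_eq_zero hs_meas (fun x hx => hT i x (hsJ hx))
      ((injOn_of_deriv_ne_zero (hJ i) (hT i)).mono hsJ) (measure_mono_null ?_ hA0)
    rintro _ ⟨_, ⟨x, hx, rfl⟩, rfl⟩
    exact ⟨T x, hx.1, (lift_coe T x).symm⟩
  refine measure_mono_null (fun x hx => ?_)
    (measure_union_null (hJ_compl.measure_zero volume) (measure_iUnion_null hpiece))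
  rw [mem_union, mem_iUnion, or_iff_not_imp_left]
  intro hxJ
  obtain ⟨i, hi⟩ : ∃ i, (x : ℝ) ∈ J i := by simpa using hxJ
  exact ⟨i, hx, hi⟩

end Nonsingular

namespace PiecewiseExpandingMap

variable (T : PiecewiseExpandingMap)

theorem exists_mem_Ioo_cut {x : unitInterval} (hx : ∀ j, (x : ℝ) ≠ T.cut j) :
    ∃ i : Fin T.pieces, (x : ℝ) ∈ Ioo (T.cut i.castSucc) (T.cut i.succ) := by
  have h_of_lt (k : Fin (T.pieces + 1)) : (x : ℝ) < T.cut k →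
      ∃ i : Fin T.pieces, (x : ℝ) ∈ Ioo (T.cut i.castSucc) (T.cut i.succ) := by
    induction k using Fin.induction with
    | zero => exact fun h => absurd x.2.1 (T.cut_zero ▸ h).not_ge
    | succ k ih =>
      intro h
      rcases lt_or_gt_of_ne (hx k.castSucc) with hk | hk
      exacts [ih hk, ⟨k, hk, h⟩]
  exact h_of_lt (Fin.last _) ((T.cut_last ▸ x.2.2).lt_of_ne (hx _))

theorem quasiMeasurePreserving : Measure.QuasiMeasurePreserving T.toFun volume volume := by
  refine quasiMeasurePreserving_of_deriv_lift_ne_zero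
    (J := fun i : Fin T.pieces => Ioo (T.cut i.castSucc) (T.cut i.succ))
    (fun _ => ordConnected_Ioo) (fun i x hx hzero => ?_) ?_
  · obtain ⟨lam, hlam, hexp⟩ := T.expanding
    have h := hexp i x hx
    rw [hzero, abs_zero] at h
    linarith
  · refine ((finite_range T.cut).preimage Subtype.val_injective.injOn).subset fun x hx => ?_
    by_contra hcut
    obtain ⟨i, hi⟩ := T.exists_mem_Ioo_cut fun j hj => hcut ⟨j, hj.symm⟩
    exact hx i hi

end PiecewiseExpandingMap

section Compositions

variable {α : Type*}

/-- The composition `T (n - 1) ∘ ⋯ ∘ T 0` of the first `n` maps of a sequence of self-maps, the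
identity for `n = 0`. It extends `orbitMap` to arbitrary maps. -/
def iterComp (T : ℕ → α → α) : ℕ → α → α
  | 0 => id
  | n + 1 => T n ∘ iterComp T n

theorem iterComp_add (T : ℕ → α → α) (j l : ℕ) :
    iterComp T (j + l) = iterComp (fun i => T (j + i)) l ∘ iterComp T j := by
  induction l with
  | zero => rfl
  | succ l ih => rw [← add_assoc, iterComp, iterComp, ih, Function.comp_assoc]

theorem quasiMeasurePreserving_iterComp [MeasurableSpace α] {μ : Measure α}
    {T : ℕ → α → α} (hT : ∀ n, Measure.QuasiMeasurePreserving (T n) μ μ) :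
    ∀ n, Measure.QuasiMeasurePreserving (iterComp T n) μ μ
  | 0 => .id μ
  | n + 1 => (hT n).comp (quasiMeasurePreserving_iterComp hT n)

theorem antitone_comap_iterComp {mα : MeasurableSpace α} {T : ℕ → α → α}
    (hT : ∀ n, Measurable (T n)) : Antitone fun k => mα.comap (iterComp T k) :=
  antitone_nat_of_succ_le fun k => by
    rw [iterComp, ← MeasurableSpace.comap_comp]
    exact MeasurableSpace.comap_mono (hT k).comap_le

end Compositions

section Decorrelation

variable {S T : unitInterval → unitInterval} {φ : unitInterval → ℝ}

theorem ae_abs_transferOp_comp_le (hS : Measure.QuasiMeasurePreserving S volume volume)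
    (hT : Measure.QuasiMeasurePreserving T volume volume) {a c v B : ℝ≥0}
    (hφ : Measurable φ) (hφc : ∀ x, |φ x| ≤ c) (hφv : eVariationOn φ univ ≤ v)
    (hφT : ∫ x, φ (T x) = 0) (hB : bvNorm (transferOp T fun _ => 1) ≤ B)
    (hdec : ∀ f, MemBV f → ∫ x, f x = 0 → bvNorm (transferOp S f) ≤ a * bvNorm f) :
    ∀ᵐ x, |transferOp (S ∘ T) (fun x => φ (T x)) x| ≤ a * ((c + v) * B) := by
  have hone : Integrable (fun _ : unitInterval => (1 : ℝ)) := integrable_const 1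
  have hφT_int : Integrable fun x => φ (T x) :=
    .of_bound (hφ.comp hT.measurable).aestronglyMeasurable c (ae_of_all _ fun _ => hφc _)
  set ψ : unitInterval → ℝ := fun x => φ x * transferOp T (fun _ => 1) x
  have hpush : transferOp T (fun x => φ (T x)) =ᵐ[volume] ψ := by
    simpa only [mul_one] using transferOp_comp_mul_ae_eq hT hone hφ hφc
  have hψ_int : Integrable ψ :=
    (integrable_transferOp hone).bdd_mul hφ.aestronglyMeasurable (ae_of_all _ hφc)
  have hψ_zero : ∫ x, ψ x = 0 := by
    rw [← integral_congr_ae hpush, integral_transferOp hT hφT_int, hφT]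
  have hψ_bv : bvNorm ψ ≤ (c + v) * B := calc
    bvNorm ψ ≤ (c + eVariationOn φ univ) * bvNorm (transferOp T fun _ => 1) :=
      bvNorm_mul_le (fun x => enorm_le_coe.2 (hφc x)) (hφv.trans_lt ENNReal.coe_lt_top).ne
    _ ≤ (c + v) * B := by gcongr
  have hψ_mem : MemBV ψ := memBV_iff.2 ⟨hψ_int, hψ_bv.trans_lt (by finiteness)⟩
  have hbound : bvNorm (transferOp S ψ) ≤ (a * ((c + v) * B) : ℝ≥0) :=
    (hdec ψ hψ_mem hψ_zero).trans (by push_cast; gcongr)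
  filter_upwards [transferOp_comp_ae_eq hS hT hφT_int, ae_enorm_le_bvNorm (transferOp S ψ)]
    with x hx hSx
  rw [hx, transferOp_congr_ae hpush]
  exact_mod_cast enorm_le_coe.1 (hSx.trans hbound)

end Decorrelation

theorem abs_condExp_sum_ae_le {Ω ι : Type*} {m mΩ : MeasurableSpace Ω} {μ : Measure Ω}
    {X : ι → Ω → ℝ} {b : ι → ℝ} {s : Finset ι} (hX : ∀ i ∈ s, Integrable (X i) μ)
    (hb : ∀ i ∈ s, ∀ᵐ ω ∂μ, |(μ[X i | m]) ω| ≤ b i) :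
    ∀ᵐ ω ∂μ, |(μ[∑ i ∈ s, X i | m]) ω| ≤ ∑ i ∈ s, b i := by
  filter_upwards [condExp_finsetSum hX m, (Finset.eventually_all s).2 hb] with ω hω hbω
  rw [hω, Finset.sum_apply]
  exact (Finset.abs_sum_le_sum_abs _ _).trans (Finset.sum_le_sum hbω)

theorem sum_range_sub_le_tsum {a : ℕ → ℝ≥0} (ha : Summable a) (k : ℕ) :
    ∑ j ∈ Finset.range k, a (k - j) ≤ ∑' i, a i := by
  have hinj : InjOn (fun j => k - j) (Finset.range k) := fun i hi j hj hij => by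
    simp only [Finset.coe_range, mem_Iio] at hi hj hij
    omega
  rw [← Finset.sum_image hinj]
  exact ha.sum_le_tsum _ fun _ _ => zero_le

section Centering

variable {Ω : Type*} {mΩ : MeasurableSpace Ω} {μ : Measure Ω} {g : Ω → unitInterval}
  {f : unitInterval → ℝ} {L : ℝ≥0}

theorem abs_sub_integral_comp_le_of_lipschitzWith [IsProbabilityMeasure μ]
    (hf : LipschitzWith L f) (hg : Measurable g) (x : unitInterval) :
    |f x - ∫ ω, f (g ω) ∂μ| ≤ L := by
  have hosc (y : unitInterval) : |f x - f y| ≤ L := by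
    refine (hf.dist_le_mul x y).trans (mul_le_of_le_one_right L.2 ?_)
    rw [Subtype.dist_eq, Real.dist_eq, abs_le]
    constructor <;> linarith [x.2.1, x.2.2, y.2.1, y.2.2]
  have hint : Integrable (fun ω => f (g ω)) μ :=
    ((BoundedContinuousFunction.mkOfCompact ⟨f, hf.continuous⟩).integrable
      (μ.map g)).comp_measurable hg
  calc |f x - ∫ ω, f (g ω) ∂μ| = ‖∫ ω, (f x - f (g ω)) ∂μ‖ := by
        rw [integral_sub (integrable_const _) hint]
        simp
    _ ≤ L * μ.real univ := norm_integral_le_of_norm_le_const (ae_of_all _ fun ω => hosc (g ω))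
    _ = L := by simp

end Centering

section Concentration

/-- The quantitative hypotheses of the concentration inequality, for a sequence of nonsingular maps:
`B` bounds the densities `P_{T₁ⁿ} 1` in `BV`, `δ` bounds them from below for `n ≥ 1`, and `a l` is
the decay factor on functions of zero average of the transfer operator of any `l` consecutive
maps. -/
structure HasBVDecay (T : ℕ → unitInterval → unitInterval) (B : ℝ≥0) (a : ℕ → ℝ≥0) (δ : ℝ≥0) :
    Prop where
  quasiMeasurePreserving : ∀ n, Measure.QuasiMeasurePreserving (T n) volume volume
  bvNorm_transferOp_one_le : ∀ n, bvNorm (transferOp (iterComp T n) fun _ => 1) ≤ B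
  bvNorm_transferOp_le : ∀ j l, 1 ≤ l → ∀ f, MemBV f → ∫ x, f x = 0 →
    bvNorm (transferOp (iterComp (fun i => T (j + i)) l) f) ≤ a l * bvNorm f
  le_transferOp_one : ∀ n, 1 ≤ n → ∀ᵐ x, δ ≤ transferOp (iterComp T n) (fun _ => 1) x

variable {T : ℕ → unitInterval → unitInterval} {B : ℝ≥0} {a : ℕ → ℝ≥0} {δ : ℝ≥0}

theorem ae_abs_condExp_comp_iterComp_le (h : HasBVDecay T B a δ) (hδ : 0 < δ)
    {φ : unitInterval → ℝ} {c v : ℝ≥0} (hφ : Measurable φ) (hφc : ∀ x, |φ x| ≤ c)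
    (hφv : eVariationOn φ univ ≤ v) {j k : ℕ} (hjk : j < k)
    (hφ0 : ∫ x, φ (iterComp T j x) = 0) :
    ∀ᵐ x, |(volume[fun x => φ (iterComp T j x) |
      MeasurableSpace.comap (iterComp T k) inferInstance]) x| ≤ a (k - j) * ((c + v) * B) / δ := by
  have hTj := quasiMeasurePreserving_iterComp h.quasiMeasurePreserving j
  have hshift := quasiMeasurePreserving_iterComp (fun i => h.quasiMeasurePreserving (j + i)) (k - j)
  have hk : iterComp T k = iterComp (fun i => T (j + i)) (k - j) ∘ iterComp T j := by
    rw [← iterComp_add, Nat.add_sub_cancel' hjk.le]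
  refine abs_condExp_comap_ae_le_div (quasiMeasurePreserving_iterComp h.quasiMeasurePreserving k)
    (.of_bound (hφ.comp hTj.measurable).aestronglyMeasurable c (ae_of_all _ fun _ => hφc _))
    hδ (h.le_transferOp_one k (by omega)) ?_
  rw [hk]
  exact ae_abs_transferOp_comp_le hshift hTj hφ hφc hφv hφ0 (h.bvNorm_transferOp_one_le j)
    (h.bvNorm_transferOp_le j (k - j) (by omega))

theorem measureReal_sum_comp_iterComp_ge_le (h : HasBVDecay T B a δ) (ha : Summable a) (hδ : 0 < δ)
    {φ : ℕ → unitInterval → ℝ} {c v : ℝ≥0} (hφ : ∀ k, Measurable (φ k))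
    (hφc : ∀ k x, |φ k x| ≤ c) (hφv : ∀ k, eVariationOn (φ k) univ ≤ v)
    (hφ0 : ∀ k, ∫ x, φ k (iterComp T k x) = 0) (n : ℕ) {ε : ℝ} (hε : 0 ≤ ε) :
    volume.real {x | ε ≤ ∑ k ∈ Finset.range n, φ k (iterComp T k x)} ≤
      Real.exp (-ε ^ 2 / (2 * ((n + 1) * (c + 2 * ((∑' l, a l) * ((c + v) * B) / δ)) ^ 2))) := by
  have hT_meas (k : ℕ) := (quasiMeasurePreserving_iterComp h.quasiMeasurePreserving k).measurable
  let X (k : ℕ) (x : unitInterval) : ℝ := φ k (iterComp T k x)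
  have hX_int (k : ℕ) : Integrable (X k) :=
    .of_bound ((hφ k).comp (hT_meas k)).aestronglyMeasurable c (ae_of_all _ fun _ => hφc k _)
  have hpast (k : ℕ) : ∀ᵐ x, |(volume[∑ j ∈ Finset.range k, X j |
      MeasurableSpace.comap (iterComp T k) inferInstance]) x| ≤
        ((∑' l, a l) * ((c + v) * B) / δ : ℝ≥0) := by
    have hcond := abs_condExp_sum_ae_le (s := Finset.range k) (fun j _ => hX_int j) fun j hj =>
      ae_abs_condExp_comp_iterComp_le (k := k) h hδ (hφ j) (hφc j) (hφv j)
        (Finset.mem_range.1 hj) (hφ0 j)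
    filter_upwards [hcond] with x hx
    refine hx.trans ?_
    rw [← Finset.sum_div, ← Finset.sum_mul]
    push_cast
    gcongr
    exact_mod_cast sum_range_sub_le_tsum ha k
  exact_mod_cast measureReal_sum_range_ge_le (X := X)
    (antitone_comap_iterComp fun k => (h.quasiMeasurePreserving k).measurable)
    (fun k => (hT_meas k).comap_le)
    (fun k => ((hφ k).comp (comap_measurable _)).stronglyMeasurable)
    (fun k => ae_of_all _ fun x => hφc k _) hφ0 hpast n hε

theorem measureReal_sum_comp_iterComp_sub_integral_ge_le
    (h : HasBVDecay T B a δ) (ha : Summable a) (hδ : 0 < δ)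
    {f : unitInterval → ℝ} {L : ℝ≥0} (hf : LipschitzWith L f) (n : ℕ) {ε : ℝ} (hε : 0 ≤ ε) :
    volume.real {x | ε ≤ ∑ k ∈ Finset.range n,
        (f (iterComp T k x) - ∫ y, f (iterComp T k y))} ≤
      Real.exp (-ε ^ 2 / (2 * ((n + 1) * ((1 + 2 * ((∑' l, a l) * (2 * B) / δ)) * L) ^ 2))) := by
  have hφ (k : ℕ) : LipschitzWith L fun x => f x - ∫ y, f (iterComp T k y) := fun x y => by
    simpa only [edist_sub_right] using hf x y
  have hdev := measureReal_sum_comp_iterComp_ge_le h ha hδ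
    (fun k => (hφ k).continuous.measurable)
    (fun k => abs_sub_integral_comp_le_of_lipschitzWith hf
      (quasiMeasurePreserving_iterComp h.quasiMeasurePreserving k).measurable)
    (fun k => eVariationOn_le_of_lipschitzWith (hφ k))
    (fun k => by
      simpa only [average_eq_integral] using
        integral_sub_average volume fun x => f (iterComp T k x))
    n hε
  convert hdev using 6
  ring

theorem exists_volume_mean_comp_iterComp_sub_integral_gt_le
    (h : HasBVDecay T B a δ) (ha : Summable a) (hδ : 0 < δ) :
    ∃ C : ℝ, 0 < C ∧
      ∀ (f : unitInterval → ℝ) (L : ℝ≥0), 0 < L → LipschitzWith L f →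
        ∀ n : ℕ, 1 ≤ n → ∀ t : ℝ, 0 < t →
          volume {x : unitInterval | t < (1 / (n : ℝ)) * ∑ k ∈ Finset.range n,
              (f (iterComp T k x) - ∫ y : unitInterval, f (iterComp T k y))}
            ≤ ENNReal.ofReal (Real.exp (-(C * n * t ^ 2 / (L : ℝ) ^ 2))) := by
  let D : ℝ := 1 + 2 * ((∑' l, a l) * (2 * B) / δ)
  have hD : 0 < D := by positivity
  refine ⟨1 / (4 * D ^ 2), by positivity, fun f L hL hf n hn t ht => ?_⟩
  have hn' : (1 : ℝ) ≤ n := by exact_mod_cast hn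
  have hdev := measureReal_sum_comp_iterComp_sub_integral_ge_le h ha hδ hf n
    (ε := n * t) (by positivity)
  have hexp : -(n * t) ^ 2 / (2 * ((n + 1) * (D * L) ^ 2)) ≤
      -(1 / (4 * D ^ 2) * n * t ^ 2 / (L : ℝ) ^ 2) := by
    rw [neg_div, neg_le_neg_iff]
    calc 1 / (4 * D ^ 2) * n * t ^ 2 / (L : ℝ) ^ 2
        = (n * t) ^ 2 / (2 * ((n + n) * (D * L) ^ 2)) := by field_simp; ring
      _ ≤ (n * t) ^ 2 / (2 * ((n + 1) * (D * L) ^ 2)) := by gcongr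
  rw [← ofReal_measureReal]
  refine ENNReal.ofReal_le_ofReal ((measureReal_mono fun x hx => ?_).trans (hdev.trans
    (Real.exp_le_exp.2 hexp)))
  rw [mem_ofPred_eq, one_div, inv_mul_eq_div, lt_div_iff₀ (by positivity), mul_comm] at hx
  exact hx.le

end Concentration

section ClassOfMaps

variable {𝒞 : Set PiecewiseExpandingMap} {T : ℕ → PiecewiseExpandingMap}

theorem iterComp_toFun (T : ℕ → PiecewiseExpandingMap) :
    iterComp (fun k => (T k).toFun) = orbitMap T := by
  ext n : 1
  induction n with
  | zero => rfl
  | succ n ih => rw [iterComp, orbitMap, ih]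

theorem transferIter_ae_eq_transferOp (S : ℕ → PiecewiseExpandingMap) {f : unitInterval → ℝ}
    (hf : Integrable f) (l : ℕ) :
    transferIter S l f =ᵐ[volume] transferOp (iterComp (fun k => (S k).toFun) l) f := by
  induction l with
  | zero => exact (transferOp_id_ae_eq hf).symm
  | succ l ih =>
    rw [transferIter, transferOp_congr_ae ih, iterComp]
    exact (transferOp_comp_ae_eq (S l).quasiMeasurePreserving
      (quasiMeasurePreserving_iterComp (fun k => (S k).quasiMeasurePreserving) l) hf).symm

theorem transferIter_add (S : ℕ → PiecewiseExpandingMap) (j l : ℕ) (f : unitInterval → ℝ) :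
    transferIter S (j + l) f = transferIter (fun i => S (j + i)) l (transferIter S j f) := by
  induction l with
  | zero => rfl
  | succ l ih => rw [← add_assoc, transferIter, transferIter, ih]

theorem integrable_transferIter (S : ℕ → PiecewiseExpandingMap) {f : unitInterval → ℝ}
    (hf : Integrable f) : ∀ n, Integrable (transferIter S n f)
  | 0 => hf
  | n + 1 => integrable_transferOp (integrable_transferIter S hf n)

theorem eLpNorm_transferIter_le (S : ℕ → PiecewiseExpandingMap) (f : unitInterval → ℝ) :
    ∀ n, eLpNorm (transferIter S n f) 1 volume ≤ eLpNorm f 1 volume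
  | 0 => le_rfl
  | n + 1 => (eLpNorm_transferOp_le (S n).quasiMeasurePreserving.measurable _).trans
      (eLpNorm_transferIter_le S f n)

theorem exists_bvNorm_transferIter_le {r : ℕ} (hr : 1 ≤ r) (hD : ConditionD 𝒞 r)
    (hT : ∀ n, T n ∈ 𝒞) {f : unitInterval → ℝ} (hf : MemBV f) :
    ∃ B : ℝ≥0, ∀ n, bvNorm (transferIter T n f) ≤ B := by
  obtain ⟨ρ, M₀, C, -, hρ, -, -, hbdd, hLY⟩ := hD
  have hmem (n : ℕ) : MemBV (transferIter T n f) := by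
    induction n with
    | zero => exact hf
    | succ n ih =>
      exact memBV_iff.2 ⟨integrable_transferIter T hf.1 _, (hbdd (T n) (hT n) _ ih).trans_lt
        (ENNReal.mul_lt_top ENNReal.coe_lt_top (memBV_iff.1 ih).2)⟩
  have hfin (n : ℕ) : bvNorm (transferIter T n f) ≠ ∞ := (memBV_iff.1 (hmem n)).2.ne
  lift eLpNorm f 1 volume to ℝ≥0 using (memLp_one_iff_integrable.2 hf.1).2.ne with N hN
  have hstep (n : ℕ) : (bvNorm (transferIter T (n + r) f)).toNNReal ≤
      ρ * (bvNorm (transferIter T n f)).toNNReal + C * N := by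
    rw [← ENNReal.coe_le_coe]
    push_cast [ENNReal.coe_toNNReal (hfin _), hN]
    rw [transferIter_add]
    refine (hLY (fun i => T (n + i)) (fun i _ => hT _) _ (hmem n)).trans ?_
    gcongr
    exact eLpNorm_transferIter_le T f n
  obtain ⟨B, hB⟩ := exists_forall_le_of_forall_add_le hr hρ
    (b := fun n => (bvNorm (transferIter T n f)).toNNReal) hstep
  exact ⟨B, fun n => by
    rw [← ENNReal.coe_toNNReal (hfin n)]
    exact_mod_cast hB n⟩

end ClassOfMaps

end SeqDyn

theorem mainTheorem3_general {𝒞 : Set SeqDyn.PiecewiseExpandingMap} {r : ℕ} (hr : 1 ≤ r)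
    (hD : SeqDyn.ConditionD 𝒞 r) (hdec : SeqDyn.ConditionDec 𝒞)
    {T : ℕ → SeqDyn.PiecewiseExpandingMap} (hT : ∀ n, T n ∈ 𝒞) (hmin : SeqDyn.ConditionMin T) :
    ∃ C : ℝ, 0 < C ∧
      ∀ (f : unitInterval → ℝ) (L : ℝ≥0), 0 < L → LipschitzWith L f →
        ∀ n : ℕ, 1 ≤ n → ∀ t : ℝ, 0 < t →
          volume {x : unitInterval | t < (1 / (n : ℝ)) * ∑ k ∈ Finset.range n,
              (f (SeqDyn.orbitMap T k x) - ∫ y : unitInterval, f (SeqDyn.orbitMap T k y))}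
            ≤ ENNReal.ofReal (Real.exp (-(C * n * t ^ 2 / (L : ℝ) ^ 2))) := by
  obtain ⟨θ, K, hθ, -, hdec⟩ := hdec
  obtain ⟨δ, hδ, hmin⟩ := hmin
  obtain ⟨B, hB⟩ := SeqDyn.exists_bvNorm_transferIter_le hr hD hT (SeqDyn.memBV_const 1)
  have htransfer {S : ℕ → SeqDyn.PiecewiseExpandingMap} (l : ℕ) {f : unitInterval → ℝ}
      (hf : Integrable f) := SeqDyn.bvNorm_congr_ae (SeqDyn.transferIter_ae_eq_transferOp S hf l)
  lift δ to ℝ≥0 using hδ.le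
  simp only [← SeqDyn.iterComp_toFun] at hmin ⊢
  have hdecay : SeqDyn.HasBVDecay (fun n => (T n).toFun) B (fun l => K * θ ^ l) δ :=
    { quasiMeasurePreserving := fun n => (T n).quasiMeasurePreserving
      bvNorm_transferOp_one_le := fun n =>
        (htransfer n (integrable_const 1)).symm.trans_le (hB n)
      bvNorm_transferOp_le := fun j l hl f hf hf0 => by
        rw [← htransfer (S := fun i => T (j + i)) l hf.1]
        exact_mod_cast hdec l hl (fun i => T (j + i)) (fun i _ => hT _) f hf hf0
      le_transferOp_one := hmin }
  exact SeqDyn.exists_volume_mean_comp_iterComp_sub_integral_gt_le hdecay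
    ((NNReal.summable_geometric hθ).mul_left K) (NNReal.coe_pos.1 hδ)

/-- The constant `L` ranges over all positive Lipschitz constants of `f`. For non-constant `f` one
may take the least one, `Lip(f)`; for constant `f` letting `L → 0` gives probability zero. -/
theorem mainTheorem3 (𝒞 : Set SeqDyn.PiecewiseExpandingMap) (h𝒞 : SeqDyn.AdmissibleClass 𝒞)
    (T : ℕ → SeqDyn.PiecewiseExpandingMap) (hT : ∀ n, T n ∈ 𝒞) (hmin : SeqDyn.ConditionMin T) :
    ∃ C : ℝ, 0 < C ∧
      ∀ (f : unitInterval → ℝ) (L : ℝ≥0), 0 < L → LipschitzWith L f →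
        ∀ n : ℕ, 1 ≤ n → ∀ t : ℝ, 0 < t →
          volume {x : unitInterval | t < (1 / (n : ℝ)) * ∑ k ∈ Finset.range n,
              (f (SeqDyn.orbitMap T k x) - ∫ y : unitInterval, f (SeqDyn.orbitMap T k y))}
            ≤ ENNReal.ofReal (Real.exp (-(C * n * t ^ 2 / (L : ℝ) ^ 2))) := by
  obtain ⟨r, hr, hD⟩ := h𝒞.condD
  exact mainTheorem3_general hr hD h𝒞.dec hT hmin
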